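/- All graphs are finite and simple. For a graph $G$ and a positive integer $r$, an $r$-matching of $G$ is a set of $r$ pairwise vertex-disjoint edges of $G$. The matching Kneser graph $(G,rK_2)$ has as vertices all $r$-matchings of $G$, two of them being adjacent when they have no edge in common; $\chi(G,rK_2)$ denotes its chromatic number. The generalized Turán number $\mathrm{ex}(G,rK_2)$ is the maximum number of edges of a spanning subgraph of $G$ that contains no $r$-matching. (1) For any positive integers $r$ and $\Theta$ with $r\ge 3$ there exists a tree $T$ of radius $2$ such that $$\chi(T,rK_2)=\Theta \quad\text{and}\quad |E(T)|-\mathrm{ex}(T,rK_2)=\Theta+r-2 .$$ (2) Consequently, for every positive integer $\Theta$ there is a sequence of trees $(T_r)_{r\ge 3}$ of radius $2$ such that, for every $r\ge 3$, $\chi(T_r,rK_2)=\Theta$ and $\chi(T_r,rK_2)\ne |E(T_r)|-\mathrm{ex}(T_r,rK_2)$, and $$\lim_{r\to\infty}\Bigl(|E(T_r)|-\mathrm{ex}(T_r,rK_2)-\chi(T_r,rK_2)\Bigr)=+\infty .$$ In particular each $T_r$ is a counterexample to the conjecture of Alishahi and Hajiabolhassan that $\chi(G,rK_2)=|E(G)|-\mathrm{ex}(G,rK_2)$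 for every connected graph $G$. -/

import Mathlib

open Filter

/-- A finite set `M` of edges of `G` is an `r`-matching if it consists of `r` edges, no two
distinct ones of which share an endpoint. -/
def IsRMatching {V : Type*} (G : SimpleGraph V) (r : ℕ) (M : Finset (Sym2 V)) : Prop :=
  (M : Set (Sym2 V)) ⊆ G.edgeSet ∧ M.card = r ∧
    ∀ e ∈ M, ∀ f ∈ M, e ≠ f → ∀ v : V, v ∈ e → v ∉ f

/-- The matching Kneser graph `(G, rK₂)`: its vertices are the `r`-matchings of `G`, and two
distinct ones are adjacent when they have no edge in common. (For `r ≥ 1` distinctness is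
automatic.) -/
def matchingKneserGraph {V : Type*} (G : SimpleGraph V) (r : ℕ) :
    SimpleGraph {M : Finset (Sym2 V) // IsRMatching G r M} where
  Adj M N := M ≠ N ∧ Disjoint M.1 N.1
  symm := ⟨fun _ _ h => ⟨h.1.symm, h.2.symm⟩⟩
  loopless := ⟨fun _ h => h.1 rfl⟩

/-- A graph is `rK₂`-free if it has no `r`-matching. -/
def IsRMatchingFree {V : Type*} (G : SimpleGraph V) (r : ℕ) : Prop :=
  ∀ M : Finset (Sym2 V), ¬ IsRMatching G r M

/-- The generalized Turán number `ex(G, rK₂)`: the maximum number of edges of an `rK₂`-free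
spanning subgraph of `G`. -/
noncomputable def matchingTuranNumber {V : Type*} (G : SimpleGraph V) (r : ℕ) : ℕ :=
  sSup {m : ℕ | ∃ H : SimpleGraph V, H ≤ G ∧ IsRMatchingFree H r ∧ H.edgeSet.ncard = m}

/-- For a finite graph and `r ≥ 1` the supremum in the definition is an attained maximum. -/
theorem matchingTuranNumber_isGreatest {V : Type*} [Finite V] (G : SimpleGraph V) (r : ℕ)
    (hr : 1 ≤ r) :
    IsGreatest {m : ℕ | ∃ H : SimpleGraph V, H ≤ G ∧ IsRMatchingFree H r ∧ H.edgeSet.ncard = m}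
      (matchingTuranNumber G r) := by
  have hb : BddAbove {m : ℕ | ∃ H : SimpleGraph V,
      H ≤ G ∧ IsRMatchingFree H r ∧ H.edgeSet.ncard = m} := by
    refine ⟨G.edgeSet.ncard, ?_⟩
    rintro m ⟨H, hH, -, rfl⟩
    exact Set.ncard_le_ncard (SimpleGraph.edgeSet_mono hH) (Set.toFinite _)
  have hn : {m : ℕ | ∃ H : SimpleGraph V,
      H ≤ G ∧ IsRMatchingFree H r ∧ H.edgeSet.ncard = m}.Nonempty := by
    refine ⟨_, ⊥, bot_le, ?_, rfl⟩
    rintro M ⟨h1, h2, -⟩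
    obtain ⟨e, he⟩ := Finset.card_pos.mp (by omega : 0 < M.card)
    simpa using h1 he
  exact ⟨Nat.sSup_mem hn hb, fun m hm => le_csSup hb hm⟩

/-- The number `|E(G)| - ex(G, rK₂)`, as an integer. -/
noncomputable def matchingTuranDefect {V : Type*} (G : SimpleGraph V) (r : ℕ) : ℤ :=
  (G.edgeSet.ncard : ℤ) - (matchingTuranNumber G r : ℤ)

/-! The witness is the spider with $n=\Theta+2r-4$ legs of length two. Inner edges all meet at the
centre, so an $r$-matching uses at most one of them and hence at least $r-1$ outer edges. Its
colouring problem is therefore that of the Kneser graph of $(r-1)$-subsets of the $n$ legs, with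
chromatic number $n-2(r-1)+2=\Theta$. The Turán number is instead $n+r-2$: all inner edges and $r-2$
outer ones are optimal. As there are $2n$ edges, the defect is $n-r+2=\Theta+r-2$.

For the upper bound, Kneser's colouring is applied to the outer edges (`spider_colorable`). For the
lower bound, an $(r-1)$-set of legs is completed to an $r$-matching by one inner edge, chosen so
that disjoint sets give disjoint matchings (`le_of_spider_colorable`); then `lovasz_kneser` applies.
That theorem comes from `octahedral_tucker`, which in turn follows from a combinatorial parity count
in the style of Ky Fan (`sum_altLabels_flags`). -/

/-! ### Alternating label sets modulo two -/

/-- A set of signed labels alternates in sign, starting with `s`, when listed by magnitude. -/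
def SignAlternating (s : Bool) (L : Finset (ℕ × Bool)) : Prop :=
  ∀ a ∈ L, a.2 = xor s (decide (Odd (L.filter fun b => b.1 < a.1).card))

/-- A new smallest label raises the rank of every other label by one, so the remaining ones must
alternate from the opposite sign. -/
theorem signAlternating_insert_min {s : Bool} {a : ℕ × Bool} {L : Finset (ℕ × Bool)}
    (h : ∀ b ∈ L, a.1 < b.1) :
    SignAlternating s (insert a L) ↔ a.2 = s ∧ SignAlternating (!s) L := by
  have ha : a ∉ L := fun h' => lt_irrefl _ (h a h')
  have h0 : ((insert a L).filter fun b => b.1 < a.1) = ∅ := by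
    ext b
    simp only [Finset.mem_filter, Finset.mem_insert, Finset.notMem_empty, iff_false, not_and]
    rintro (rfl | hb)
    · exact lt_irrefl _
    · exact (h b hb).not_gt
  have h1 : ∀ c ∈ L, ((insert a L).filter fun b => b.1 < c.1).card
      = (L.filter fun b => b.1 < c.1).card + 1 := by
    intro c hc
    rw [Finset.filter_insert, if_pos (h c hc), Finset.card_insert_of_notMem]
    simp [ha]
  unfold SignAlternating
  rw [Finset.forall_mem_insert, h0]
  refine and_congr (by simp) (forall₂_congr fun c hc => ?_)
  rw [h1 c hc]
  by_cases ho : Odd (L.filter fun b => b.1 < c.1).card <;> cases s <;> simp [ho, Nat.odd_add_one]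

theorem signAlternating_image_neg (s : Bool) (L : Finset (ℕ × Bool)) :
    SignAlternating s (L.image fun a => (a.1, !a.2)) ↔ SignAlternating (!s) L := by
  unfold SignAlternating
  rw [Finset.forall_mem_image]
  refine forall₂_congr fun a _ => ?_
  have : ((L.image fun a : ℕ × Bool => (a.1, !a.2)).filter fun b => b.1 < a.1).card
      = (L.filter fun b => b.1 < a.1).card := by
    rw [Finset.filter_image, Finset.card_image_of_injective]
    rintro ⟨x, y⟩ ⟨x', y'⟩ h
    simpa using h
  simp only [this]
  cases a.2 <;> cases s <;> simp

open Classical in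
/-- The indicator, modulo two, of `SignAlternating`. -/
noncomputable def altInd (s : Bool) (L : Finset (ℕ × Bool)) : ZMod 2 :=
  if SignAlternating s L then 1 else 0

open Classical in
theorem altInd_insert_min {s : Bool} {a : ℕ × Bool} {L : Finset (ℕ × Bool)}
    (h : ∀ b ∈ L, a.1 < b.1) :
    altInd s (insert a L) = if a.2 = s then altInd (!s) L else 0 := by
  unfold altInd
  rw [signAlternating_insert_min h]
  by_cases h1 : a.2 = s <;> simp [h1]

/-- If `L` alternates from `s`, only erasing its last label keeps that pattern; if it alternates
from `!s`, only erasing its first does. Otherwise a good erasure removes one of two neighbours of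
equal sign, so good erasures come in pairs. -/
theorem sum_altInd_erase (L : Finset (ℕ × Bool)) :
    Set.InjOn Prod.fst (L : Set (ℕ × Bool)) → ∀ s,
    ∑ a ∈ L, altInd s (L.erase a) = altInd s L + altInd (!s) L := by
  induction L using Finset.induction_on_min_value (fun a : ℕ × Bool => a.1) with
  | empty =>
    intro _ s
    have : ∀ s, altInd s ∅ = 1 := fun s => by simp [altInd, SignAlternating]
    simp only [Finset.sum_empty, this]
    decide
  | insert a L ha hmin ih =>
    intro hinj s
    have hlt : ∀ b ∈ L, a.1 < b.1 := fun b hb => lt_of_le_of_ne (hmin b hb) fun he =>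
      ha (by
        have := hinj (by simp) (by simp [hb]) he
        rwa [this])
    have ih' := ih (hinj.mono (by simp))
    rw [Finset.sum_insert ha, Finset.erase_insert ha, altInd_insert_min hlt,
      altInd_insert_min hlt]
    have : ∀ b ∈ L, altInd s ((insert a L).erase b)
        = if a.2 = s then altInd (!s) (L.erase b) else 0 := by
      intro b hb
      have hab : a ≠ b := fun h => ha (h ▸ hb)
      rw [Finset.erase_insert_of_ne hab, altInd_insert_min]
      exact fun c hc => hlt c (Finset.mem_of_mem_erase hc)
    rw [Finset.sum_congr rfl this]
    have two : ∀ x : ZMod 2, x + x = 0 := by decide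
    by_cases hs : a.2 = s
    · have hs' : a.2 ≠ !s := by rw [hs]; cases s <;> simp
      simp only [hs, if_true, ih' (!s), Bool.not_not]
      have hs2 : (s = !s) = False := by cases s <;> simp
      simp only [hs2, if_false]
      linear_combination two (altInd s L)
    · have hs' : a.2 = !s := by cases h : a.2 <;> cases s <;> simp_all
      simp [hs']

open Classical in
/-- The indicator, modulo two, of the labels `l i`, `i ∈ I`, being distinct and alternating. -/
noncomputable def altLabels (s : Bool) (I : Finset ℕ) (l : ℕ → ℕ × Bool) : ZMod 2 :=
  if (I.image l).card = I.card then altInd s (I.image l) else 0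

theorem altLabels_congr {s : Bool} {I : Finset ℕ} {l l' : ℕ → ℕ × Bool}
    (h : ∀ i ∈ I, l i = l' i) : altLabels s I l = altLabels s I l' := by
  unfold altLabels
  rw [Finset.image_congr (fun i hi => h i hi)]

theorem altLabels_neg (s : Bool) (I : Finset ℕ) (l : ℕ → ℕ × Bool) :
    altLabels s I (fun i => ((l i).1, !(l i).2)) = altLabels (!s) I l := by
  have hc : I.image (fun i => ((l i).1, !(l i).2))
      = (I.image l).image fun a => (a.1, !a.2) := by
    rw [Finset.image_image]; rfl
  unfold altLabels altInd
  rw [hc, signAlternating_image_neg, Finset.card_image_of_injective]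
  rintro ⟨x, y⟩ ⟨x', y'⟩ h
  simpa using h

/-- With distinct labels this is `sum_altInd_erase`, since `h` makes their magnitudes distinct. If
`l i = l j` with `i ≠ j`, only erasing `i` or `j` can leave distinct labels, and both erasures leave
the same set, so they cancel. -/
theorem sum_altLabels_erase (s : Bool) (I : Finset ℕ) (l : ℕ → ℕ × Bool)
    (h : ∀ i ∈ I, ∀ j ∈ I, (l i).1 = (l j).1 → (l i).2 = (l j).2) :
    ∑ i ∈ I, altLabels s (I.erase i) l = altLabels s I l + altLabels (!s) I l := by
  classical
  by_cases hinj : Set.InjOn l I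
  · have hc : ∀ J ⊆ I, altLabels s J l = altInd s (J.image l) := fun J hJ => by
      rw [altLabels, if_pos (Finset.card_image_of_injOn (hinj.mono (by simpa using hJ)))]
    have hc' : altLabels (!s) I l = altInd (!s) (I.image l) := by
      rw [altLabels, if_pos (Finset.card_image_of_injOn hinj)]
    rw [hc I subset_rfl, hc', ← sum_altInd_erase, Finset.sum_image hinj]
    · refine Finset.sum_congr rfl fun i hi => ?_
      rw [hc _ (Finset.erase_subset _ _)]
      congr 1
      ext a
      simp only [Finset.mem_image, Finset.mem_erase]
      constructor
      · rintro ⟨j, ⟨hj, hj'⟩, rfl⟩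
        exact ⟨fun he => hj (hinj hj' hi he), j, hj', rfl⟩
      · rintro ⟨hne, j, hj, rfl⟩
        exact ⟨j, ⟨fun he => hne (he ▸ rfl), hj⟩, rfl⟩
    · intro a ha b hb hab
      simp only [Finset.coe_image, Set.mem_image, Finset.mem_coe] at ha hb
      obtain ⟨i, hi, rfl⟩ := ha
      obtain ⟨j, hj, rfl⟩ := hb
      exact Prod.ext hab (h i hi j hj hab)
  · have hz : ∀ s, altLabels s I l = 0 := fun s => by
      rw [altLabels, if_neg (fun hc => hinj (Finset.card_image_iff.mp hc))]
    have hinj' := hinj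
    simp only [Set.InjOn, not_forall] at hinj'
    obtain ⟨i, hi, j, hj, hij, hne⟩ := hinj'
    rw [hz, hz, add_zero]
    rw [Finset.mem_coe] at hi hj
    have himg : ∀ i ∈ I, ∀ j ∈ I, l i = l j → i ≠ j → (I.erase i).image l = I.image l := by
      intro i hi j hj hij hne
      ext a
      simp only [Finset.mem_image, Finset.mem_erase]
      constructor
      · rintro ⟨k, ⟨-, hk⟩, rfl⟩
        exact ⟨k, hk, rfl⟩
      · rintro ⟨k, hk, rfl⟩
        by_cases hki : k = i
        · exact ⟨j, ⟨Ne.symm hne, hj⟩, by rw [hki, hij]⟩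
        · exact ⟨k, ⟨hki, hk⟩, rfl⟩
    have hother : ∀ k ∈ I, k ≠ i ∧ k ≠ j → altLabels s (I.erase k) l = 0 := by
      rintro k hk ⟨hki, hkj⟩
      rw [altLabels, if_neg]
      intro hc
      exact hne (Finset.card_image_iff.mp hc (by simp [hi, Ne.symm hki]) (by simp [hj, Ne.symm hkj]) hij)
    rw [← Finset.sum_subset (s₁ := {i, j}) (by
        intro k; simp only [Finset.mem_insert, Finset.mem_singleton]
        rintro (rfl | rfl) <;> assumption)
      (fun k hk hk' => hother k hk (by simpa using hk')), Finset.sum_pair hne]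
    have : altLabels s (I.erase i) l = altLabels s (I.erase j) l := by
      unfold altLabels
      rw [himg i hi j hj hij hne, himg j hj i hi hij.symm (Ne.symm hne), Finset.card_erase_of_mem hi,
        Finset.card_erase_of_mem hj]
    rw [this]
    exact (by decide : ∀ x : ZMod 2, x + x = 0) _

/-! ### Maximal chains of sign vectors and Ky Fan's parity theorem -/

/-- The coordinates of sign `b` in the `i`-th member of the maximal chain of sign vectors given by
an ordering `F.1` of the coordinates and a choice of signs `F.2`. -/
def flagPart {n : ℕ} (F : Equiv.Perm (Fin n) × (Fin n → Bool)) (b : Bool) (i : ℕ) :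
    Finset (Fin n) :=
  Finset.univ.filter fun j => (F.1.symm j).val < i ∧ F.2 j = b

theorem mem_flagPart {n : ℕ} {F : Equiv.Perm (Fin n) × (Fin n → Bool)} {b : Bool} {i : ℕ}
    {j : Fin n} : j ∈ flagPart F b i ↔ (F.1.symm j).val < i ∧ F.2 j = b := by
  simp [flagPart]

/-- The labels along a maximal chain of sign vectors. -/
def flagLabel {n : ℕ} (lam : Finset (Fin n) → Finset (Fin n) → ℕ × Bool)
    (F : Equiv.Perm (Fin n) × (Fin n → Bool)) (i : ℕ) : ℕ × Bool :=
  lam (flagPart F true i) (flagPart F false i)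

/-- The chains that are standard, with positive signs, from the coordinate `d` on. -/
def flagsBelow (n d : ℕ) : Finset (Equiv.Perm (Fin n) × (Fin n → Bool)) :=
  Finset.univ.filter fun F => ∀ j, d ≤ j.val → F.1 j = j ∧ F.2 j = true

theorem mem_flagsBelow {n d : ℕ} {F : Equiv.Perm (Fin n) × (Fin n → Bool)} :
    F ∈ flagsBelow n d ↔ ∀ j, d ≤ j.val → F.1 j = j ∧ F.2 j = true := by
  simp [flagsBelow]

theorem disjoint_flagPart {n : ℕ} (F : Equiv.Perm (Fin n) × (Fin n → Bool)) (i : ℕ) :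
    Disjoint (flagPart F true i) (flagPart F false i) := by
  rw [Finset.disjoint_left]
  simp only [flagPart, Finset.mem_filter, Finset.mem_univ, true_and, not_and, and_imp]
  intro a _ h _ h'
  simp [h] at h'

theorem flagPart_mono {n : ℕ} (F : Equiv.Perm (Fin n) × (Fin n → Bool)) (b : Bool) {i j : ℕ}
    (h : i ≤ j) : flagPart F b i ⊆ flagPart F b j := by
  intro a
  simp only [flagPart, Finset.mem_filter, Finset.mem_univ, true_and]
  exact fun ⟨h1, h2⟩ => ⟨h1.trans_le h, h2⟩

theorem flagPart_nonempty {n : ℕ} (hn : 0 < n) (F : Equiv.Perm (Fin n) × (Fin n → Bool)) {i : ℕ}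
    (h : 1 ≤ i) : (flagPart F true i ∪ flagPart F false i).Nonempty := by
  refine ⟨F.1 ⟨0, hn⟩, ?_⟩
  simp only [flagPart, Finset.mem_union, Finset.mem_filter, Finset.mem_univ, true_and,
    Equiv.symm_apply_apply]
  cases F.2 (F.1 ⟨0, hn⟩) <;> simp <;> omega

theorem flag_symm_apply {n d : ℕ} {F : Equiv.Perm (Fin n) × (Fin n → Bool)}
    (hF : F ∈ flagsBelow n d) {j : Fin n} (hj : d ≤ j.val) : F.1.symm j = j := by
  rw [Equiv.symm_apply_eq]; exact (mem_flagsBelow.mp hF j hj).1.symm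

/-- Interchanging two consecutive coordinates of a chain changes a single member of it. -/
theorem sum_altLabels_erase_swap {n d : ℕ} (lam : Finset (Fin n) → Finset (Fin n) → ℕ × Bool)
    (P : (Fin n → Bool) → Prop) [DecidablePred P] (I : Finset ℕ) {i : ℕ} (hi : 1 ≤ i) (hid : i < d) (hdn : d ≤ n) :
    ∑ F ∈ (flagsBelow n d).filter (fun F => P F.2), altLabels true (I.erase i) (flagLabel lam F)
      = 0 := by
  have hab : (⟨i - 1, by omega⟩ : Fin n) ≠ ⟨i, by omega⟩ := by
    intro h; have := congrArg Fin.val h; simp at this; omega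
  set a : Fin n := ⟨i - 1, by omega⟩ with ha
  set b : Fin n := ⟨i, by omega⟩ with hb
  refine Finset.sum_involution (fun F _ => ((Equiv.swap a b).trans F.1, F.2)) ?_ ?_ ?_ ?_
  · intro F _
    have : altLabels true (I.erase i) (flagLabel lam F) = altLabels true (I.erase i)
        (flagLabel lam ((Equiv.swap a b).trans F.1, F.2)) := by
      refine altLabels_congr fun k hk => ?_
      have hki : k ≠ i := Finset.ne_of_mem_erase hk
      have : ∀ s, flagPart F s k = flagPart ((Equiv.swap a b).trans F.1, F.2) s k := by
        intro s
        ext j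
        rw [mem_flagPart, mem_flagPart, Equiv.symm_trans_apply, Equiv.symm_swap]
        refine and_congr_left fun _ => ?_
        rw [Equiv.swap_apply_def]
        split_ifs with h1 h2
        · rw [h1, ha, hb]; dsimp only; omega
        · rw [h2, ha, hb]; dsimp only; omega
        · rfl
      simp only [flagLabel, this]
    rw [← this]
    exact (by decide : ∀ x : ZMod 2, x + x = 0) _
  · intro F _ _ h
    have h1 := congrArg (fun G => G.1 a) h
    simp only [Equiv.trans_apply, Equiv.swap_apply_left] at h1
    exact hab (F.1.injective h1).symm
  · intro F hF
    rw [Finset.mem_filter, mem_flagsBelow] at hF ⊢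
    refine ⟨fun j hj => ⟨?_, (hF.1 j hj).2⟩, hF.2⟩
    rw [Equiv.trans_apply, Equiv.swap_apply_of_ne_of_ne]
    · exact (hF.1 j hj).1
    · rintro rfl; rw [ha] at hj; dsimp only at hj; omega
    · rintro rfl; rw [hb] at hj; dsimp only at hj; omega
  · intro F _
    refine Prod.ext ?_ rfl
    ext j
    simp

open Classical in
/-- Changing the last sign of a chain changes its top member only. -/
theorem sum_altLabels_flip {n d : ℕ} (lam : Finset (Fin n) → Finset (Fin n) → ℕ × Bool)
    (e : Fin n) (he : e.val = d) :
    ∑ F ∈ ((flagsBelow n (d + 1)).filter (fun F => F.2 e = true)).filter (fun F => F.1 e ≠ e),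
      altLabels true (Finset.Icc 1 d) (flagLabel lam F) = 0 := by
  refine Finset.sum_involution
    (fun F _ => (F.1, Function.update F.2 (F.1 e) (!(F.2 (F.1 e))))) ?_ ?_ ?_ ?_
  · intro F _
    have : altLabels true (Finset.Icc 1 d) (flagLabel lam F) = altLabels true (Finset.Icc 1 d)
        (flagLabel lam (F.1, Function.update F.2 (F.1 e) (!(F.2 (F.1 e))))) := by
      refine altLabels_congr fun k hk => ?_
      have hki := Finset.mem_Icc.mp hk
      have : ∀ s, flagPart F s k
          = flagPart (F.1, Function.update F.2 (F.1 e) (!(F.2 (F.1 e)))) s k := by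
        intro s
        ext j
        simp only [flagPart, Finset.mem_filter, Finset.mem_univ, true_and]
        refine and_congr_right fun h => ?_
        rw [Function.update_of_ne]
        rintro rfl
        rw [Equiv.symm_apply_apply] at h
        omega
      simp only [flagLabel, this]
    rw [← this]
    exact (by decide : ∀ x : ZMod 2, x + x = 0) _
  · intro F _ _ h
    have h1 := congrArg (fun G => G.2 (F.1 e)) h
    simp at h1
  · intro F hF
    rw [Finset.mem_filter, Finset.mem_filter, mem_flagsBelow] at hF ⊢
    obtain ⟨⟨h1, h2⟩, h3⟩ := hF
    refine ⟨⟨fun j hj => ⟨(h1 j hj).1, ?_⟩, ?_⟩, h3⟩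
    · dsimp only
      rw [Function.update_of_ne, (h1 j hj).2]
      intro hje
      have : e = j := F.1.injective (hje.symm.trans (h1 j hj).1.symm)
      subst this
      omega
    · dsimp only
      rw [Function.update_of_ne h3.symm, h2]
  · intro F _
    refine Prod.ext rfl ?_
    simp

open Classical in
/-- Chains with negative and with positive sign at the last free coordinate are exchanged by
negation. -/
theorem sum_altLabels_neg {n d : ℕ} (lam : Finset (Fin n) → Finset (Fin n) → ℕ × Bool)
    (hanti : ∀ A B, Disjoint A B → (A ∪ B).Nonempty → lam B A = ((lam A B).1, !(lam A B).2))
    (e : Fin n) (he : e.val = d) :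
    ∑ F ∈ (flagsBelow n (d + 1)).filter (fun F => ¬ F.2 e = true),
      altLabels true (Finset.Icc 1 (d + 1)) (flagLabel lam F)
    = ∑ F ∈ (flagsBelow n (d + 1)).filter (fun F => F.2 e = true),
      altLabels false (Finset.Icc 1 (d + 1)) (flagLabel lam F) := by
  have hn : 0 < n := e.pos
  -- Only coordinates up to `d` are negated, so the later ones keep the positive signs that
  -- `flagsBelow` demands; the first `d + 1` members of a chain do not see those.
  let ν : Equiv.Perm (Fin n) × (Fin n → Bool) → Equiv.Perm (Fin n) × (Fin n → Bool) :=
    fun F => (F.1, fun j => if j.val ≤ d then !(F.2 j) else F.2 j)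
  have hν : ∀ F, ν (ν F) = F := by
    intro F
    refine Prod.ext rfl ?_
    funext j
    by_cases h : j.val ≤ d <;> simp [ν, h]
  have hmem : ∀ F ∈ flagsBelow n (d + 1), ν F ∈ flagsBelow n (d + 1) := by
    intro F hF
    rw [mem_flagsBelow] at hF ⊢
    intro j hj
    refine ⟨(hF j hj).1, ?_⟩
    have : ¬ j.val ≤ d := by omega
    simp [ν, this, (hF j hj).2]
  refine Finset.sum_nbij' ν ν ?_ ?_ (fun F _ => hν F) (fun F _ => hν F) ?_
  · intro F hF
    rw [Finset.mem_filter] at hF ⊢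
    exact ⟨hmem F hF.1, by simpa [ν, he] using hF.2⟩
  · intro F hF
    rw [Finset.mem_filter] at hF ⊢
    exact ⟨hmem F hF.1, by simpa [ν, he] using hF.2⟩
  · intro F hF
    rw [Finset.mem_filter] at hF
    have hpart : ∀ s, ∀ i ∈ Finset.Icc 1 (d + 1), flagPart (ν F) s i = flagPart F (!s) i := by
      intro s i hi
      rw [Finset.mem_Icc] at hi
      ext j
      simp only [flagPart, Finset.mem_filter, Finset.mem_univ, true_and, ν]
      refine and_congr_right fun h => ?_
      have : j.val ≤ d := by
        by_contra hj
        rw [flag_symm_apply hF.1 (by omega)] at h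
        omega
      rw [if_pos this]
      cases s <;> simp
    rw [show false = !true from rfl, ← altLabels_neg]
    refine altLabels_congr fun i hi => ?_
    have h1 := hanti _ _ (disjoint_flagPart F i)
      (flagPart_nonempty hn F (Finset.mem_Icc.mp hi).1)
    simp only [flagLabel, hpart _ i hi, Bool.not_true, Bool.not_false, h1, Bool.not_not]

open Classical in
/-- Ky Fan's parity theorem for the barycentric subdivision of the cross-polytope. -/
theorem sum_altLabels_flags {n : ℕ} (lam : Finset (Fin n) → Finset (Fin n) → ℕ × Bool)
    (hanti : ∀ A B, Disjoint A B → (A ∪ B).Nonempty → lam B A = ((lam A B).1, !(lam A B).2))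
    (hcomp : ∀ A B A' B', A ⊆ A' → B ⊆ B' → Disjoint A' B' → (A ∪ B).Nonempty →
      (lam A B).1 = (lam A' B').1 → (lam A B).2 = (lam A' B').2)
    (d : ℕ) (hd : d ≤ n) :
    ∑ F ∈ flagsBelow n d, altLabels true (Finset.Icc 1 d) (flagLabel lam F) = 1 := by
  induction d with
  | zero =>
    have : flagsBelow n 0 = {(1, fun _ => true)} := by
      ext F
      simp only [mem_flagsBelow, Nat.zero_le, true_imp_iff, Finset.mem_singleton]
      constructor
      · intro h
        exact Prod.ext (Equiv.ext fun j => (h j).1) (funext fun j => (h j).2)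
      · rintro rfl j
        simp
    rw [this, Finset.sum_singleton]
    simp [altLabels, altInd, SignAlternating]
  | succ d ih =>
    have hn : 0 < n := by omega
    obtain ⟨e, he⟩ : ∃ e : Fin n, e.val = d := ⟨⟨d, by omega⟩, rfl⟩
    have hloc : ∀ F, ∀ i ∈ Finset.Icc 1 (d + 1), ∀ j ∈ Finset.Icc 1 (d + 1),
        (flagLabel lam F i).1 = (flagLabel lam F j).1 →
          (flagLabel lam F i).2 = (flagLabel lam F j).2 := by
      intro F i hi j hj h
      rcases le_total i j with hij | hij
      · exact hcomp _ _ _ _ (flagPart_mono F _ hij) (flagPart_mono F _ hij)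
          (disjoint_flagPart F j) (flagPart_nonempty hn F (Finset.mem_Icc.mp hi).1) h
      · exact (hcomp _ _ _ _ (flagPart_mono F _ hij) (flagPart_mono F _ hij)
          (disjoint_flagPart F i) (flagPart_nonempty hn F (Finset.mem_Icc.mp hj).1) h.symm).symm
    -- Negation folds the sum onto the hemisphere where `e` is positive, at the price of counting
    -- both starting signs; together these count the alternating facets of each chain.
    rw [← Finset.sum_filter_add_sum_filter_not _ (fun F => F.2 e = true),
      sum_altLabels_neg lam hanti e he, ← Finset.sum_add_distrib]
    have hsum : ∀ F ∈ (flagsBelow n (d + 1)).filter (fun F => F.2 e = true),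
        altLabels true (Finset.Icc 1 (d + 1)) (flagLabel lam F)
          + altLabels false (Finset.Icc 1 (d + 1)) (flagLabel lam F)
        = ∑ i ∈ Finset.Icc 1 (d + 1),
          altLabels true ((Finset.Icc 1 (d + 1)).erase i) (flagLabel lam F) := fun F _ =>
      (sum_altLabels_erase true _ _ (hloc F)).symm
    -- Facets missing a member below the top lie in two chains of the hemisphere and cancel, so only
    -- `i = d + 1` survives.
    rw [Finset.sum_congr rfl hsum, Finset.sum_comm, Finset.sum_eq_single (d + 1)]
    · have hI : (Finset.Icc 1 (d + 1)).erase (d + 1) = Finset.Icc 1 d := by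
        ext k; simp only [Finset.mem_erase, Finset.mem_Icc]; omega
      -- If the last coordinate added is not `e`, flipping its sign cancels the facet. The chains
      -- that add `e` last are those of the equator, counted by the induction hypothesis.
      rw [hI, ← Finset.sum_filter_add_sum_filter_not _ (fun F => F.1 e = e),
        sum_altLabels_flip lam e he, add_zero, ← ih (by omega)]
      congr 1
      ext F
      simp only [Finset.mem_filter, mem_flagsBelow]
      constructor
      · rintro ⟨⟨h1, h2⟩, h3⟩ j hj
        rcases hj.lt_or_eq with hj | hj
        · exact h1 j hj
        · have : j = e := Fin.ext (by omega)
          subst this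
          exact ⟨h3, h2⟩
      · intro h
        exact ⟨⟨fun j hj => h j (by omega), (h e he.ge).2⟩, (h e he.ge).1⟩
    · intro i hi hne
      rw [Finset.mem_Icc] at hi
      exact sum_altLabels_erase_swap lam (fun ε => ε e = true) (Finset.Icc 1 (d + 1)) hi.1
        (by omega) hd
    · intro h
      exact absurd (Finset.mem_Icc.mpr ⟨by omega, le_rfl⟩) h

/-! ### Tucker's lemma and the Lovász–Kneser theorem -/

/-- The octahedral Tucker lemma. -/
theorem octahedral_tucker {n m : ℕ} (lam : Finset (Fin n) → Finset (Fin n) → ℕ × Bool)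
    (hanti : ∀ A B, Disjoint A B → (A ∪ B).Nonempty → lam B A = ((lam A B).1, !(lam A B).2))
    (hcomp : ∀ A B A' B', A ⊆ A' → B ⊆ B' → Disjoint A' B' → (A ∪ B).Nonempty →
      (lam A B).1 = (lam A' B').1 → (lam A B).2 = (lam A' B').2)
    (hlt : ∀ A B, Disjoint A B → (A ∪ B).Nonempty → (lam A B).1 < m) : n ≤ m := by
  classical
  rcases Nat.eq_zero_or_pos n with rfl | hn
  · exact Nat.zero_le _
  have hsum := sum_altLabels_flags lam hanti hcomp n le_rfl
  -- An odd count yields a chain with `n` distinct labels; by `hcomp` their magnitudes are distinct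
  -- too, and all lie below `m`.
  obtain ⟨F, -, hF⟩ := Finset.exists_ne_zero_of_sum_ne_zero (hsum.trans_ne one_ne_zero)
  have hcard : ((Finset.Icc 1 n).image (flagLabel lam F)).card = (Finset.Icc 1 n).card := by
    by_contra h
    exact hF (if_neg h)
  have hinj := Finset.card_image_iff.mp hcard
  have hinj' : Set.InjOn (fun i => (flagLabel lam F i).1) (Finset.Icc 1 n : Finset ℕ) := by
    intro i hi j hj h
    refine hinj hi hj (Prod.ext h ?_)
    rw [Finset.mem_coe, Finset.mem_Icc] at hi hj
    rcases le_total i j with hij | hij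
    · exact hcomp _ _ _ _ (flagPart_mono F _ hij) (flagPart_mono F _ hij)
        (disjoint_flagPart F j) (flagPart_nonempty hn F hi.1) h
    · exact (hcomp _ _ _ _ (flagPart_mono F _ hij) (flagPart_mono F _ hij)
        (disjoint_flagPart F i) (flagPart_nonempty hn F hj.1) h.symm).symm
  have := Finset.card_le_card_of_injOn (s := Finset.Icc 1 n) (t := Finset.range m) _
    (fun i hi => Finset.mem_range.mpr (hlt _ _ (disjoint_flagPart F i)
      (flagPart_nonempty hn F (Finset.mem_Icc.mp hi).1))) hinj'
  simpa using this

/-- The Lovász–Kneser theorem: a proper colouring of the `k`-subsets of an `n`-set, in which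
disjoint sets get different colours, uses at least `n - 2k + 2` colours. -/
theorem lovasz_kneser {n k d : ℕ} (hk : 1 ≤ k) (c : Finset (Fin n) → ℕ)
    (hd : ∀ A, A.card = k → c A < d)
    (hc : ∀ A B, A.card = k → B.card = k → Disjoint A B → c A ≠ c B) :
    n ≤ 2 * k - 2 + d := by
  classical
  let cols : Finset (Fin n) → Finset (Fin n) → Set ℕ := fun A B =>
    {x | ∃ K, (K ⊆ A ∨ K ⊆ B) ∧ K.card = k ∧ c K = x}
  have cols_comm : ∀ A B, cols A B = cols B A := by
    intro A B; ext x; simp only [cols, Set.mem_ofPred_eq, or_comm]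
  have cols_mem : ∀ A B, Disjoint A B → ¬ A.card + B.card ≤ 2 * k - 2 →
      sInf (cols A B) ∈ cols A B := by
    intro A B _ h
    apply Nat.sInf_mem
    -- Disjoint sets with at least `2 * k - 1` elements in all cannot both have fewer than `k`.
    rcases le_or_gt k A.card with hA | hA
    · obtain ⟨K, hK, hK'⟩ := Finset.exists_subset_card_eq hA
      exact ⟨_, K, Or.inl hK, hK', rfl⟩
    · obtain ⟨K, hK, hK'⟩ := Finset.exists_subset_card_eq (show k ≤ B.card by omega)
      exact ⟨_, K, Or.inr hK, hK', rfl⟩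
  -- Small pairs get magnitudes `0, …, 2 * k - 3` by size, signed by the side holding the least
  -- element. Large pairs get the least colour of a `k`-set within one side, shifted by `2 * k - 2`
  -- and signed by that side.
  let lam : Finset (Fin n) → Finset (Fin n) → ℕ × Bool := fun A B =>
    if A.card + B.card ≤ 2 * k - 2 then
      (A.card + B.card - 1, decide (∃ a ∈ A, ∀ b ∈ B, a < b))
    else (2 * k - 2 + sInf (cols A B),
      decide (∃ K, K ⊆ A ∧ K.card = k ∧ c K = sInf (cols A B)))
  have pos : ∀ A B : Finset (Fin n), Disjoint A B → (A ∪ B).Nonempty → 1 ≤ A.card + B.card := by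
    intro A B h h'
    rw [← Finset.card_union_of_disjoint h]
    exact h'.card_pos
  refine octahedral_tucker lam ?_ ?_ ?_
  · intro A B hAB hne
    by_cases h : A.card + B.card ≤ 2 * k - 2
    · have h' : B.card + A.card ≤ 2 * k - 2 := by omega
      simp only [lam, if_pos h, if_pos h', Prod.mk.injEq]
      refine ⟨by omega, ?_⟩
      rw [← decide_not, decide_eq_decide]
      constructor
      · rintro ⟨b, hb, hb'⟩ ⟨a, ha, ha'⟩
        exact lt_asymm (hb' a ha) (ha' b hb)
      · intro hno
        have hm := Finset.min'_mem (A ∪ B) hne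
        have hm' := fun x hx => Finset.min'_le (A ∪ B) x hx
        set y := (A ∪ B).min' hne
        rcases Finset.mem_union.mp hm with hy | hy
        · refine absurd ⟨y, hy, fun b hb => lt_of_le_of_ne (hm' b (by simp [hb])) ?_⟩ hno
          rintro rfl
          exact Finset.disjoint_left.mp hAB hy hb
        · refine ⟨y, hy, fun b hb => lt_of_le_of_ne (hm' b (by simp [hb])) ?_⟩
          rintro rfl
          exact Finset.disjoint_left.mp hAB hb hy
    · have h' : ¬ B.card + A.card ≤ 2 * k - 2 := by omega
      simp only [lam, if_neg h, if_neg h', cols_comm B A, true_and, Prod.mk.injEq]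
      rw [← decide_not, decide_eq_decide]
      constructor
      · rintro ⟨K, hK, hK1, hK2⟩ ⟨K', hK', hK1', hK2'⟩
        exact hc K' K hK1' hK1 (Finset.disjoint_of_subset_left hK'
          (Finset.disjoint_of_subset_right hK hAB)) (hK2'.trans hK2.symm)
      · intro hno
        obtain ⟨K, hK | hK, hK1, hK2⟩ := cols_mem A B hAB h
        · exact absurd ⟨K, hK, hK1, hK2⟩ hno
        · exact ⟨K, hK, hK1, hK2⟩
  · intro A B A' B' hA hB hAB' hne heq
    have hAB : Disjoint A B := Finset.disjoint_of_subset_left hA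
      (Finset.disjoint_of_subset_right hB hAB')
    have hp := pos A B hAB hne
    have cA := Finset.card_le_card hA
    have cB := Finset.card_le_card hB
    -- Nested small pairs of equal magnitude coincide, and a small and a large pair never share a
    -- magnitude. For two large pairs, opposite signs would give disjoint `k`-sets of one colour.
    by_cases h : A.card + B.card ≤ 2 * k - 2 <;> by_cases h' : A'.card + B'.card ≤ 2 * k - 2
    · simp only [lam, if_pos h, if_pos h'] at heq
      rw [Finset.eq_of_subset_of_card_le hA (by omega),
        Finset.eq_of_subset_of_card_le hB (by omega)]
    · simp only [lam, if_pos h, if_neg h'] at heq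
      omega
    · omega
    · simp only [lam, if_neg h, if_neg h'] at heq ⊢
      have heq' : sInf (cols A B) = sInf (cols A' B') := by omega
      rw [decide_eq_decide, ← heq']
      constructor
      · rintro ⟨K, hK, hK'⟩
        exact ⟨K, hK.trans hA, hK'⟩
      · rintro ⟨K, hK, hK1, hK2⟩
        obtain ⟨K', hK' | hK', hK1', hK2'⟩ := cols_mem A B hAB h
        · exact ⟨K', hK', hK1', hK2'⟩
        · exact absurd (hK2.trans hK2'.symm) (hc K K' hK1 hK1' (Finset.disjoint_of_subset_left hK
            (Finset.disjoint_of_subset_right (hK'.trans hB) hAB')))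
  · intro A B hAB hne
    have hp := pos A B hAB hne
    by_cases h : A.card + B.card ≤ 2 * k - 2
    · simp only [lam, if_pos h]
      omega
    · simp only [lam, if_neg h]
      obtain ⟨K, -, hK1, hK2⟩ := cols_mem A B hAB h
      have := hd K hK1
      omega

/-- Addition is cyclic in `Fin n`, so a nonempty set closed under successor is everything. -/
theorem Fin.exists_mem_add_one_notMem {n : ℕ} [NeZero n] {A : Finset (Fin n)} (h0 : A.Nonempty)
    (h1 : A ≠ Finset.univ) : ∃ a ∈ A, a + 1 ∉ A := by
  by_contra! h
  obtain ⟨a, ha⟩ := h0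
  have key : ∀ t : ℕ, a + Fin.ofNat n t ∈ A := by
    intro t
    induction t with
    | zero => simpa using ha
    | succ t ih =>
      have := h _ ih
      rwa [add_assoc, show Fin.ofNat n t + 1 = Fin.ofNat n (t + 1) by
        ext; simp [Fin.val_add]] at this
  refine h1 (Finset.eq_univ_iff_forall.mpr fun b => ?_)
  have := key (b - a).val
  simpa using this

/-! ### The spider and its matchings -/

/-- The edges of the spider with `n` legs of length two: `(i, false)` stands for the inner and
`(i, true)` for the outer edge of the leg `i`. -/
def spiderEdge {n : ℕ} : Fin n × Bool → Sym2 (Option (Fin n × Bool))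
  | (i, false) => s(none, some (i, false))
  | (i, true) => s(some (i, false), some (i, true))

/-- The spider with `n` legs of length two. -/
def spider (n : ℕ) : SimpleGraph (Option (Fin n × Bool)) :=
  SimpleGraph.fromEdgeSet (Set.range spiderEdge)

theorem spiderEdge_injective (n : ℕ) : Function.Injective (spiderEdge (n := n)) := by
  rintro ⟨i, b⟩ ⟨j, b'⟩ h
  cases b <;> cases b' <;> simp_all [spiderEdge]

theorem edgeSet_fromEdgeSet_spider {n : ℕ} (S : Set (Fin n × Bool)) :
    (SimpleGraph.fromEdgeSet (spiderEdge '' S)).edgeSet = spiderEdge '' S := by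
  rw [SimpleGraph.edgeSet_fromEdgeSet, sdiff_eq_left, Set.disjoint_left]
  rintro _ ⟨⟨i, b⟩, -, rfl⟩
  cases b <;> simp [spiderEdge]

theorem edgeSet_spider (n : ℕ) : (spider n).edgeSet = Set.range spiderEdge := by
  rw [spider, ← Set.image_univ, edgeSet_fromEdgeSet_spider]

theorem spiderEdge_common {n : ℕ} {p q : Fin n × Bool} {v : Option (Fin n × Bool)}
    (hp : v ∈ spiderEdge p) (hq : v ∈ spiderEdge q) : p.1 = q.1 ∨ p.2 = false ∧ q.2 = false := by
  obtain ⟨i, b⟩ := p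
  obtain ⟨j, b'⟩ := q
  cases b <;> cases b' <;> simp only [spiderEdge, Sym2.mem_iff] at hp hq <;>
    rcases hp with rfl | rfl <;> simp_all

theorem isRMatching_image_spiderEdge {n r : ℕ} {H : SimpleGraph (Option (Fin n × Bool))}
    {S : Finset (Fin n × Bool)} (hS : ∀ p ∈ S, spiderEdge p ∈ H.edgeSet) (hr : S.card = r)
    (h1 : ∀ p ∈ S, ∀ q ∈ S, p ≠ q → p.1 ≠ q.1)
    (h2 : ∀ p ∈ S, ∀ q ∈ S, p ≠ q → p.2 = false → q.2 = true) :
    IsRMatching H r (S.map ⟨spiderEdge, spiderEdge_injective n⟩) := by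
  refine ⟨?_, by rw [Finset.card_map, hr], ?_⟩
  · intro e he
    simp only [Finset.coe_map, Function.Embedding.coeFn_mk, Set.mem_image, Finset.mem_coe] at he
    obtain ⟨p, hp, rfl⟩ := he
    exact hS p hp
  · intro e he f hf hef v hve hvf
    rw [Finset.mem_map] at he hf
    obtain ⟨p, hp, rfl⟩ := he
    obtain ⟨q, hq, rfl⟩ := hf
    have hpq : p ≠ q := fun h => hef (h ▸ rfl)
    rcases spiderEdge_common hve hvf with h | ⟨h, h'⟩
    · exact h1 p hp q hq hpq h
    · simp [h2 p hp q hq hpq h] at h'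

/-- The legs whose outer (`b = true`) or inner (`b = false`) edge belongs to `M`. -/
def spiderLegs {n : ℕ} (M : Finset (Sym2 (Option (Fin n × Bool)))) (b : Bool) : Finset (Fin n) :=
  Finset.univ.filter fun i => spiderEdge (i, b) ∈ M

theorem mem_spiderLegs {n : ℕ} {M : Finset (Sym2 (Option (Fin n × Bool)))} {b : Bool} {i : Fin n} :
    i ∈ spiderLegs M b ↔ spiderEdge (i, b) ∈ M := by
  simp [spiderLegs]

theorem card_spiderLegs {n : ℕ} {M : Finset (Sym2 (Option (Fin n × Bool)))}
    (hM : (M : Set (Sym2 (Option (Fin n × Bool)))) ⊆ Set.range spiderEdge) :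
    M.card = (spiderLegs M true).card + (spiderLegs M false).card := by
  classical
  have h1 : M = (Finset.univ.filter fun p : Fin n × Bool => spiderEdge p ∈ M).map
      ⟨spiderEdge, spiderEdge_injective n⟩ := by
    ext e
    simp only [Finset.mem_map, Finset.mem_filter, Finset.mem_univ, true_and,
      Function.Embedding.coeFn_mk]
    constructor
    · intro he
      obtain ⟨p, rfl⟩ := hM he
      exact ⟨p, he, rfl⟩
    · rintro ⟨p, hp, rfl⟩
      exact hp
  have h2 : (Finset.univ.filter fun p : Fin n × Bool => spiderEdge p ∈ M)
      = (spiderLegs M true ×ˢ {true}) ∪ (spiderLegs M false ×ˢ {false}) := by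
    ext ⟨i, b⟩
    cases b <;> simp [mem_spiderLegs]
  have h3 := congrArg Finset.card h1
  rw [Finset.card_map, h2, Finset.card_union_of_disjoint, Finset.card_product,
    Finset.card_product] at h3
  · simpa using h3
  · rw [Finset.disjoint_left]
    rintro ⟨i, b⟩ h h'
    simp only [Finset.mem_product, Finset.mem_singleton] at h h'
    simp [h.2] at h'

theorem card_spiderLegs_false_le {n r : ℕ} {H : SimpleGraph (Option (Fin n × Bool))}
    {M : Finset (Sym2 (Option (Fin n × Bool)))} (hM : IsRMatching H r M) :
    (spiderLegs M false).card ≤ 1 := by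
  rw [Finset.card_le_one]
  intro i hi j hj
  rw [mem_spiderLegs] at hi hj
  by_contra hij
  refine hM.2.2 _ hi _ hj (fun h => hij ?_) none (by simp [spiderEdge]) (by simp [spiderEdge])
  exact congrArg Prod.fst (spiderEdge_injective n h)

theorem card_spiderLegs_true_ge {n r : ℕ} {M : Finset (Sym2 (Option (Fin n × Bool)))}
    (hM : IsRMatching (spider n) r M) : r - 1 ≤ (spiderLegs M true).card := by
  have h1 := card_spiderLegs (hM.1.trans (edgeSet_spider n).subset)
  have h2 := card_spiderLegs_false_le hM
  have h3 := hM.2.1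
  omega

theorem isRMatching_outer {n r : ℕ} {H : SimpleGraph (Option (Fin n × Bool))} {A : Finset (Fin n)}
    (hA : ∀ i ∈ A, spiderEdge (i, true) ∈ H.edgeSet) (hr : A.card = r) :
    ∃ M, IsRMatching H r M := by
  refine ⟨_, isRMatching_image_spiderEdge (S := A ×ˢ {true}) ?_ (by simpa using hr) ?_ ?_⟩
  · rintro ⟨i, b⟩ h
    simp only [Finset.mem_product, Finset.mem_singleton] at h
    rw [h.2]
    exact hA i h.1
  · rintro ⟨i, b⟩ h ⟨j, b'⟩ h' hne heq
    simp only [Finset.mem_product, Finset.mem_singleton] at h h' heq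
    exact hne (by rw [heq, h.2, h'.2])
  · rintro ⟨i, b⟩ h ⟨j, b'⟩ h' hne heq
    simp only [Finset.mem_product, Finset.mem_singleton] at h h' heq
    exact h'.2

/-- The matching of the outer edges of the legs in `A` and the inner edge of the leg `j`. -/
def spiderMatching {n : ℕ} (A : Finset (Fin n)) (j : Fin n) :
    Finset (Sym2 (Option (Fin n × Bool))) :=
  (insert (j, false) (A ×ˢ {true})).map ⟨spiderEdge, spiderEdge_injective n⟩

theorem isRMatching_spiderMatching {n k : ℕ} {H : SimpleGraph (Option (Fin n × Bool))}
    {A : Finset (Fin n)} {j : Fin n} (hA : ∀ i ∈ A, spiderEdge (i, true) ∈ H.edgeSet)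
    (hj : spiderEdge (j, false) ∈ H.edgeSet) (hjA : j ∉ A) (hk : A.card = k) :
    IsRMatching H (k + 1) (spiderMatching A j) := by
  refine isRMatching_image_spiderEdge ?_ ?_ ?_ ?_
  · rintro ⟨i, b⟩ h
    simp only [Finset.mem_insert, Prod.mk.injEq, Finset.mem_product, Finset.mem_singleton] at h
    rcases h with ⟨rfl, rfl⟩ | ⟨h, rfl⟩
    · exact hj
    · exact hA i h
  · rw [Finset.card_insert_of_notMem (by simp), Finset.card_product, hk]
    simp
  · rintro ⟨i, b⟩ h ⟨i', b'⟩ h' hne heq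
    simp only [Finset.mem_insert, Prod.mk.injEq, Finset.mem_product, Finset.mem_singleton]
      at h h' heq
    subst heq
    rcases h with ⟨rfl, rfl⟩ | ⟨h, rfl⟩ <;> rcases h' with ⟨h', rfl⟩ | ⟨h', rfl⟩ <;> simp_all
  · rintro ⟨i, b⟩ h ⟨i', b'⟩ h' hne heq
    simp only [Finset.mem_insert, Prod.mk.injEq, Finset.mem_product, Finset.mem_singleton]
      at h h' heq
    rcases h with ⟨rfl, rfl⟩ | ⟨h, rfl⟩ <;> rcases h' with ⟨h', rfl⟩ | ⟨h', rfl⟩ <;> simp_all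

/-! ### The Turán number of the spider -/

theorem ncard_edgeSet_spider (n : ℕ) : (spider n).edgeSet.ncard = 2 * n := by
  rw [edgeSet_spider, ← Set.image_univ, Set.ncard_image_of_injective _ (spiderEdge_injective n),
    Set.ncard_univ]
  simp [mul_comm]

theorem ncard_edgeSet_le_of_isRMatchingFree {n r : ℕ} (hrn : r ≤ n)
    {H : SimpleGraph (Option (Fin n × Bool))} (hH : H ≤ spider n) (hfree : IsRMatchingFree H r) :
    H.edgeSet.ncard + 2 ≤ n + r := by
  classical
  have hsub : H.edgeSet ⊆ Set.range spiderEdge :=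
    (SimpleGraph.edgeSet_mono hH).trans (edgeSet_spider n).subset
  have hcard := card_spiderLegs (M := H.edgeSet.toFinset) (by simpa using hsub)
  have hmem : ∀ b, ∀ i ∈ spiderLegs H.edgeSet.toFinset b, spiderEdge (i, b) ∈ H.edgeSet :=
    fun b i hi => by simpa using mem_spiderLegs.mp hi
  rw [← Set.ncard_eq_toFinset_card'] at hcard
  set A := spiderLegs H.edgeSet.toFinset true
  set B := spiderLegs H.edgeSet.toFinset false
  have hB : B.card ≤ n := by simpa using Finset.card_le_univ B
  have hA : A.card < r := by
    by_contra! h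
    obtain ⟨A', hA', hc⟩ := Finset.exists_subset_card_eq h
    obtain ⟨M, hM⟩ := isRMatching_outer (fun i hi => hmem true i (hA' hi)) hc
    exact hfree M hM
  -- Too many edges force all `n` inner edges and exactly `r - 1` outer ones; an inner edge on a leg
  -- outside `A` then completes an `r`-matching.
  by_contra! h
  obtain ⟨j, hjB, hjA⟩ := Finset.exists_mem_notMem_of_card_lt_card (show A.card < B.card by omega)
  have := isRMatching_spiderMatching (hmem true) (hmem false j hjB) hjA rfl
  rw [show A.card + 1 = r by omega] at this
  exact hfree _ this

theorem matchingTuranNumber_spider {n r : ℕ} (hr : 2 ≤ r) (hrn : r ≤ n) :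
    matchingTuranNumber (spider n) r + 2 = n + r := by
  classical
  have hg := matchingTuranNumber_isGreatest (spider n) r (by omega)
  obtain ⟨H, hH, hfree, hHc⟩ := hg.1
  refine le_antisymm (hHc ▸ ncard_edgeSet_le_of_isRMatchingFree hrn hH hfree) ?_
  -- The extremal subgraph: every inner edge and `r - 2` outer edges, one too few for an
  -- `r`-matching.
  set S : Set (Fin n × Bool) := {p | p.2 = true → p.1.val < r - 2}
  have hle : SimpleGraph.fromEdgeSet (spiderEdge '' S) ≤ spider n :=
    SimpleGraph.fromEdgeSet_mono (Set.image_subset_range _ _)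
  have hS : ∀ i b, spiderEdge (i, b) ∈ (SimpleGraph.fromEdgeSet (spiderEdge '' S)).edgeSet ↔
      (b = true → i.val < r - 2) := by
    intro i b
    rw [edgeSet_fromEdgeSet_spider, (spiderEdge_injective n).mem_set_image]
    rfl
  have hfin : (Finset.univ.filter fun i : Fin n => i.val < r - 2).card = r - 2 := by
    rw [Fin.card_filter_val_lt]; omega
  have := hg.2 ⟨SimpleGraph.fromEdgeSet (spiderEdge '' S), hle, ?_, rfl⟩
  · have hc := card_spiderLegs
      (M := (SimpleGraph.fromEdgeSet (spiderEdge '' S)).edgeSet.toFinset) (by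
        rw [Set.coe_toFinset, edgeSet_fromEdgeSet_spider]; exact Set.image_subset_range _ _)
    have h1 : spiderLegs (SimpleGraph.fromEdgeSet (spiderEdge '' S)).edgeSet.toFinset true
        = Finset.univ.filter fun i : Fin n => i.val < r - 2 := by
      ext i
      rw [mem_spiderLegs, Set.mem_toFinset, hS]
      simp
    have h2 : spiderLegs (SimpleGraph.fromEdgeSet (spiderEdge '' S)).edgeSet.toFinset false
        = Finset.univ := by
      ext i
      rw [mem_spiderLegs, Set.mem_toFinset, hS]
      simp
    rw [← Set.ncard_eq_toFinset_card', h1, h2, hfin, Finset.card_univ, Fintype.card_fin] at hc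
    omega
  · intro M hM
    have hc := card_spiderLegs (hM.1.trans
      ((SimpleGraph.edgeSet_mono hle).trans (edgeSet_spider n).subset))
    have h1 := card_spiderLegs_false_le hM
    have h2 : (spiderLegs M true).card ≤ r - 2 := by
      rw [← hfin]
      refine Finset.card_le_card fun i hi => ?_
      rw [Finset.mem_filter]
      exact ⟨Finset.mem_univ i, (hS i true).mp (hM.1 (mem_spiderLegs.mp hi)) rfl⟩
    have h3 := hM.2.1
    omega

/-! ### Tree structure and radius -/

theorem spider_adj_inner {n : ℕ} (i : Fin n) : (spider n).Adj none (some (i, false)) := by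
  rw [← SimpleGraph.mem_edgeSet, edgeSet_spider]
  exact ⟨(i, false), rfl⟩

theorem spider_adj_outer {n : ℕ} (i : Fin n) :
    (spider n).Adj (some (i, false)) (some (i, true)) := by
  rw [← SimpleGraph.mem_edgeSet, edgeSet_spider]
  exact ⟨(i, true), rfl⟩

theorem eq_of_spider_adj_leaf {n : ℕ} {i : Fin n} {u : Option (Fin n × Bool)}
    (h : (spider n).Adj u (some (i, true))) : u = some (i, false) := by
  rw [← SimpleGraph.mem_edgeSet, edgeSet_spider] at h
  obtain ⟨⟨j, b⟩, hp⟩ := h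
  cases b <;> simp [spiderEdge] at hp
  rw [← hp.1, hp.2]

theorem spider_exists_walk {n : ℕ} (v : Option (Fin n × Bool)) :
    ∃ w : (spider n).Walk none v, w.length ≤ 2 := by
  rcases v with _ | ⟨i, _ | _⟩
  · exact ⟨.nil, by simp⟩
  · exact ⟨(spider_adj_inner i).toWalk, by simp⟩
  · exact ⟨.cons (spider_adj_inner i) (spider_adj_outer i).toWalk, by simp⟩

theorem spider_isTree (n : ℕ) : (spider n).IsTree := by
  rw [SimpleGraph.isTree_iff_connected_and_card]
  constructor
  · rw [SimpleGraph.connected_iff_exists_forall_reachable]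
    exact ⟨none, fun v => (spider_exists_walk v).choose.reachable⟩
  · rw [Nat.card_coe_set_eq, ncard_edgeSet_spider]
    simp [mul_comm]

theorem spider_radius {n : ℕ} (hn : 2 ≤ n) : (spider n).radius = 2 := by
  apply le_antisymm
  · refine SimpleGraph.radius_le_eccent.trans ((SimpleGraph.eccent_le_iff (u := none) _).mpr ?_)
    intro v
    obtain ⟨w, hw⟩ := spider_exists_walk v
    exact (SimpleGraph.edist_le w).trans (by exact_mod_cast hw)
  · obtain ⟨u, hu⟩ := (spider n).exists_eccent_eq_radius
    rw [← hu]
    by_contra! hlt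
    have h1 : (spider n).eccent u ≤ 1 := Order.le_of_lt_add_one (by rwa [one_add_one_eq_two])
    rw [SimpleGraph.eccent_le_one_iff] at h1
    -- Some leg avoids `u`, and its leaf is not adjacent to `u`.
    obtain ⟨i, hi, hi'⟩ : ∃ i : Fin n, u ≠ some (i, true) ∧ u ≠ some (i, false) := by
      have : Nontrivial (Fin n) := Fin.nontrivial_iff_two_le.mpr hn
      rcases u with _ | ⟨j, b⟩
      · exact ⟨⟨0, by omega⟩, by simp, by simp⟩
      · obtain ⟨i, hi⟩ := exists_ne j
        exact ⟨i, by simp [hi.symm], by simp [hi.symm]⟩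
    exact hi' (eq_of_spider_adj_leaf (h1 _ hi))

/-! ### The chromatic number -/

/-- Kneser's colouring: the least leg with an outer edge in the matching, capped at `t`. Disjoint
matchings sharing a colour would have all their outer edges on the last `n - t ≤ 2 * r - 3` legs,
but together they need `2 * (r - 1)`. -/
theorem spider_colorable {n r t : ℕ} (hn : n + 3 ≤ t + 2 * r) (hr : 2 ≤ r) :
    (matchingKneserGraph (spider n) r).Colorable (t + 1) := by
  classical
  have hne : ∀ M : {M // IsRMatching (spider n) r M}, (spiderLegs M.1 true).Nonempty := fun M => by
    have := card_spiderLegs_true_ge M.2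
    exact Finset.card_pos.mp (by omega)
  refine ⟨SimpleGraph.Coloring.mk
    (fun M => Fin.ofNat (t + 1) (min ((spiderLegs M.1 true).min' (hne M)).val t)) ?_⟩
  rintro M N ⟨-, hMN⟩ heq
  have hdis : ∀ i, i ∈ spiderLegs M.1 true → i ∉ spiderLegs N.1 true := fun i hi hi' =>
    Finset.disjoint_left.mp hMN (mem_spiderLegs.mp hi) (mem_spiderLegs.mp hi')
  have hM := Finset.min'_mem _ (hne M)
  have hN := Finset.min'_mem _ (hne N)
  have hM' := fun i hi => Finset.min'_le (spiderLegs M.1 true) i hi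
  have hN' := fun i hi => Finset.min'_le (spiderLegs N.1 true) i hi
  set a := (spiderLegs M.1 true).min' (hne M)
  set b := (spiderLegs N.1 true).min' (hne N)
  have heq' : min a.val t = min b.val t := by
    have := congrArg Fin.val heq
    simp only [Fin.ofNat] at this
    rwa [Nat.mod_eq_of_lt (by omega), Nat.mod_eq_of_lt (by omega)] at this
  by_cases hab : a = b
  · exact hdis a hM (hab ▸ hN)
  · have hab' : a.val ≠ b.val := fun h => hab (Fin.ext h)
    have hle : (spiderLegs M.1 true ∪ spiderLegs N.1 true).card ≤ n - t := by
      have hcard : (Finset.univ.filter fun i : Fin n => ¬ i.val < t).card ≤ n - t := by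
        have := Finset.card_filter_add_card_filter_not (s := Finset.univ)
          (fun i : Fin n => i.val < t)
        rw [Fin.card_filter_val_lt, Finset.card_univ, Fintype.card_fin] at this
        omega
      refine (Finset.card_le_card fun i hi => ?_).trans hcard
      rw [Finset.mem_filter]
      refine ⟨Finset.mem_univ i, ?_⟩
      rcases Finset.mem_union.mp hi with hi | hi
      · have := hM' i hi
        rw [Fin.le_def] at this
        omega
      · have := hN' i hi
        rw [Fin.le_def] at this
        omega
    rw [Finset.card_union_of_disjoint (Finset.disjoint_left.mpr hdis)] at hle
    have h1 := card_spiderLegs_true_ge M.2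
    have h2 := card_spiderLegs_true_ge N.2
    omega

/-- Each `k`-set `A` takes the inner edge of a leg just after `A` in cyclic order. For disjoint sets
the predecessors `f A` and `f B` differ, hence so do the inner edges, and the matchings are
disjoint. -/
theorem le_of_spider_colorable {n k t : ℕ} (hk : 1 ≤ k) (hkn : k < n)
    (h : (matchingKneserGraph (spider n) (k + 1)).Colorable t) : n ≤ 2 * k - 2 + t := by
  classical
  obtain ⟨c⟩ := h
  have : NeZero n := ⟨by omega⟩
  have hex : ∀ A : Finset (Fin n), A.card = k → ∃ a ∈ A, a + 1 ∉ A := by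
    intro A hA
    refine Fin.exists_mem_add_one_notMem (Finset.card_pos.mp (by omega)) ?_
    rintro rfl
    rw [Finset.card_univ, Fintype.card_fin] at hA
    omega
  choose! f hf hf' using hex
  have hmatch : ∀ A : Finset (Fin n), A.card = k →
      IsRMatching (spider n) (k + 1) (spiderMatching A (f A + 1)) := fun A hA =>
    isRMatching_spiderMatching (fun i _ => edgeSet_spider n ▸ ⟨_, rfl⟩)
      (edgeSet_spider n ▸ ⟨_, rfl⟩) (hf' A hA) hA
  let col : Finset (Fin n) → ℕ := fun A =>
    if hA : A.card = k then (c ⟨_, hmatch A hA⟩).val else 0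
  refine lovasz_kneser hk col ?_ ?_
  · intro A hA
    simp only [col, dif_pos hA]
    exact (c _).isLt
  · intro A B hA hB hAB heq
    simp only [col, dif_pos hA, dif_pos hB] at heq
    have hd : Disjoint (spiderMatching A (f A + 1)) (spiderMatching B (f B + 1)) := by
      rw [spiderMatching, spiderMatching, Finset.disjoint_map, Finset.disjoint_left]
      rintro ⟨i, b⟩ h h'
      simp only [Finset.mem_insert, Prod.mk.injEq, Finset.mem_product, Finset.mem_singleton]
        at h h'
      rcases h with ⟨rfl, rfl⟩ | ⟨h, rfl⟩
      · rcases h' with ⟨h', -⟩ | ⟨-, h'⟩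
        · rw [add_left_inj] at h'
          exact Finset.disjoint_left.mp hAB (hf A hA) (h' ▸ hf B hB)
        · simp at h'
      · rcases h' with ⟨-, h'⟩ | ⟨h', -⟩
        · simp at h'
        · exact Finset.disjoint_left.mp hAB h h'
    refine c.valid (v := ⟨_, hmatch A hA⟩) (w := ⟨_, hmatch B hB⟩) ⟨fun he => ?_, hd⟩ (Fin.ext heq)
    have he' := congrArg Subtype.val he
    dsimp only at he'
    rw [← he', disjoint_self, Finset.bot_eq_empty] at hd
    have := (hmatch A hA).2.1
    rw [hd, Finset.card_empty] at this
    omega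

theorem chromaticNumber_matchingKneserGraph_spider {n r t : ℕ} (hr : 2 ≤ r)
    (hn : n + 3 = t + 2 * r) (hrn : r ≤ n) :
    (matchingKneserGraph (spider n) r).chromaticNumber = ((t + 1 : ℕ) : ℕ∞) := by
  push_cast
  rw [SimpleGraph.chromaticNumber_eq_iff_colorable_not_colorable]
  refine ⟨spider_colorable hn.le hr, fun h => ?_⟩
  obtain ⟨k, rfl⟩ : ∃ k, r = k + 1 := ⟨r - 1, by omega⟩
  have := le_of_spider_colorable (by omega) (by omega) h
  omega

/-! ### Choice of parameters and the limit -/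

theorem exists_tree_chromaticNumber_turanDefect (r Θ : ℕ) (hr : 3 ≤ r) (hΘ : 1 ≤ Θ) :
    ∃ (V : Type) (_ : Finite V) (T : SimpleGraph V),
      T.IsTree ∧ T.radius = 2 ∧
      (matchingKneserGraph T r).chromaticNumber = (Θ : ℕ∞) ∧
      matchingTuranDefect T r = (Θ : ℤ) + (r : ℤ) - 2 := by
  obtain ⟨t, rfl⟩ : ∃ t, Θ = t + 1 := ⟨Θ - 1, by omega⟩
  obtain ⟨n, hn⟩ : ∃ n, n + 3 = t + 2 * r := ⟨t + 2 * r - 3, by omega⟩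
  refine ⟨_, inferInstance, spider n, spider_isTree n, spider_radius (by omega),
    chromaticNumber_matchingKneserGraph_spider (by omega) hn (by omega), ?_⟩
  have h := matchingTuranNumber_spider (n := n) (r := r) (by omega) (by omega)
  rw [matchingTuranDefect, ncard_edgeSet_spider]
  omega

theorem corollary1 :
    (∀ r Θ : ℕ, 3 ≤ r → 1 ≤ Θ →
      ∃ (V : Type) (_ : Finite V) (T : SimpleGraph V),
        T.IsTree ∧ T.radius = 2 ∧
        (matchingKneserGraph T r).chromaticNumber = (Θ : ℕ∞) ∧
        matchingTuranDefect T r = (Θ : ℤ) + (r : ℤ) - 2) ∧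
    (∀ Θ : ℕ, 1 ≤ Θ →
      ∃ (V : ℕ → Type) (_ : ∀ r, Finite (V r)) (T : ∀ r, SimpleGraph (V r)),
        (∀ r, 3 ≤ r →
          (T r).IsTree ∧ (T r).radius = 2 ∧
          (matchingKneserGraph (T r) r).chromaticNumber = (Θ : ℕ∞) ∧
          ((matchingKneserGraph (T r) r).chromaticNumber.toNat : ℤ)
            ≠ matchingTuranDefect (T r) r) ∧
        Tendsto
          (fun r => matchingTuranDefect (T r) r -
            ((matchingKneserGraph (T r) r).chromaticNumber.toNat : ℤ)) atTop atTop) := by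
  refine ⟨exists_tree_chromaticNumber_turanDefect, fun Θ hΘ => ?_⟩
  have hex : ∀ r, ∃ (V : Type) (_ : Finite V) (T : SimpleGraph V), 3 ≤ r →
      T.IsTree ∧ T.radius = 2 ∧
      (matchingKneserGraph T r).chromaticNumber = (Θ : ℕ∞) ∧
      matchingTuranDefect T r = (Θ : ℤ) + (r : ℤ) - 2 := by
    intro r
    by_cases hr : 3 ≤ r
    · obtain ⟨V, hV, T, h⟩ := exists_tree_chromaticNumber_turanDefect r Θ hr hΘ
      exact ⟨V, hV, T, fun _ => h⟩
    · exact ⟨Unit, inferInstance, ⊥, fun h => absurd h hr⟩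
  choose V hV T hT using hex
  refine ⟨V, hV, T, fun r hr => ?_, ?_⟩
  · obtain ⟨h1, h2, h3, h4⟩ := hT r hr
    refine ⟨h1, h2, h3, ?_⟩
    rw [h3, h4, ENat.toNat_natCast]
    omega
  · have hlim : Tendsto (fun r : ℕ => (r : ℤ) + (-2)) atTop atTop :=
      tendsto_atTop_add_const_right _ _ tendsto_natCast_atTop_atTop
    refine hlim.congr' ?_
    filter_upwards [eventually_ge_atTop 3] with r hr
    obtain ⟨-, -, h3, h4⟩ := hT r hr
    rw [h3, h4, ENat.toNat_natCast]
    ring
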